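/- **Setting.** Let $G$ be a finite connected simple undirected graph with $n$ nodes, $m$ edges and maximum degree $\Delta$. Nodes are anonymous and have no memory; at each node of degree $\delta$ the incident edges carry distinct port numbers $0,\dots,\delta-1$ (the two port numbers of an edge are unrelated). There are $k$ robots with distinct labels, placed arbitrarily on the nodes. In each synchronous round every robot communicates with the robots at its node, computes, and then optionally moves along one edge, learning the port through which it enters the new node. When several robots contend to dock at a node, a MUTEX selects exactly one of them, arbitrarily. **Algorithm Helping-Sync.** Each robot has the variables $port\_entered=-1$, $parent\_ptr=-1$, $state=explore$, $seen=0$; when it docks it also gets the arrays $visited[1..k]$ and $entry\_port[1..k]$. In rounds $0,1,\dots,4m-2(n-1)$ (or forever, if the robots do not know $m$) robot $i$ does the following. * If it is settled, then for every other robot $j$ at the node it sends $visited[j]$, $entry\_port[j]$ to $j$, and if $visited[j]=0$ it sets $visited[j]\gets1$ and $entry\_port[j]\gets$ the value $port\_entered$ of $j$; it does not move. Otherwise, if the round is not round $0$, it first sets $port\_entered$ and $parent\_ptr$ to the port through which it entered the node, and $seen\gets 0$. * If $state=explore$ and a robot docked in an earlier round is at the node: it receives $seen$, $parent\_ptr$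 (that robot's $visited[i]$, $entry\_port[i]$). If $seen=1$ it sets $state\gets backtrack$ and moves through $port\_entered$. If $seen=0$ it sets $parent\_ptr\gets port\_entered$ and makes a forward step. * If $state=explore$ and no robot docked in an earlier round is at the node: if it wins the MUTEX it docks ($state\gets settled$), and sets $visited[j]\gets1$ and $entry\_port[j]\gets$ the value $port\_entered$ of $j$ for the other robots $j$ at the node (all other entries being $0$ and $-1$). If it loses, it makes a forward step. * If $state=backtrack$: it receives $seen$, $parent\_ptr$ from the docked robot, sets $port\_entered\gets(port\_entered+1)\bmod\delta$, sets $state\gets explore$ if $port\_entered\ne parent\_ptr$, and moves through $port\_entered$. A forward step sets $port\_entered\gets(port\_entered+1)\bmod\delta$, sets $state\gets backtrack$ if $port\_entered=parent\_ptr$, and moves through $port\_entered$. **Theorem.** There is an absolute constant $C$ such that, for all $G$, port numbers, $k$, initial positions and MUTEX outcomes, with $T=4m-2n+2$: 1. For every $k$ (also $k>n$), a robot that has not docked after $T$ rounds has visited every node within these $T$ rounds (initial position included). 2. If $k\le n$, then dispersion is achieved: after $T$ rounds (after one round if $n=1$), and at all later times, all robots are docked, at pairwise distinct nodes, and they never move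 again. 3. $T\le C\,m$, so the number of rounds is $O(m)$. A round counter with values up to $T$ takes at most $C\log_2 n$ bits. 4. For all $k$ and $\Delta$ there is $B\le C\,k\log_2\max(2,\Delta)$ such that the label and all the variables listed above (round counter excluded) of every robot can be stored in $B$ bits: one encoding with $B$ bits, depending only on $k$ and $\Delta$, is injective on all contents that a robot's memory has between rounds, over all executions by $k\le n$ robots on connected graphs of maximum degree $\Delta$. -/

import Mathlib

universe u

namespace Dispersion

/-- A port labelling of a finite graph: the edges incident to a node `v` are identified, at `v`, by
the labels `0, …, deg v - 1`.  The two labels of an edge at its two ends are unrelated. -/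
abbrev PortLabelling {V : Type u} [Fintype V] [DecidableEq V] (G : SimpleGraph V)
    [DecidableRel G.Adj] : Type u :=
  ∀ v : V, Fin (G.degree v) ≃ G.neighborSet v

/-- The three values of the variable `state` of a robot. -/
inductive Phase
  | explore
  | backtrack
  | settled
  deriving DecidableEq

/-- The variables of a robot.  Ports are integers, `-1` standing for "no port".  The two arrays
are used only once the robot is settled. -/
structure Memory (k : ℕ) where
  portEntered : ℤ
  parentPtr : ℤ
  state : Phase
  seen : Bool
  visited : Fin k → Bool
  entryPort : Fin k → ℤ

/-- Initialization of the variables. -/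
def Memory.init (k : ℕ) : Memory k where
  portEntered := -1
  parentPtr := -1
  state := .explore
  seen := false
  visited := fun _ => false
  entryPort := fun _ => -1

/-- At the start of round `t`, a robot that is not settled stores, if `t > 0`, the port `e` through
which it entered its current node, and clears `seen`. -/
def sense {k : ℕ} (t : ℕ) (e : ℤ) (M : Memory k) : Memory k :=
  if M.state ≠ .settled ∧ 0 < t then
    { M with portEntered := e, parentPtr := e, seen := false }
  else M

/-- The robot (with its memory) that is already docked at the node, among the other robots present
there. -/
def dockedRobot {k : ℕ} (others : Fin k → Option (Memory k)) : Option (Memory k) :=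
  (List.finRange k).findSome? fun j =>
    (others j).bind fun M => if M.state = .settled then some M else none

/-- Forward step of an exploring robot at a node of degree `δ`: it takes the next port, and
switches to `backtrack` if this is the port to the parent. -/
def forward {k : ℕ} (δ : ℕ) (M : Memory k) : Memory k × Option ℤ :=
  let p := (M.portEntered + 1) % (δ : ℤ)
  ({ M with
      portEntered := p
      state := if p = M.parentPtr then .backtrack else .explore }, some p)

/-- The code that robot `i` executes in one round after `sense`.  It sees its own memory `M`, the
degree `δ` of its node, what the other robots present at the node communicate (`others j = none` if
`j` is not there), and the outcome of the MUTEX at the node.  It returns its new memory and the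
port through which it moves, if it does. -/
def code {k : ℕ} (i : Fin k) (M : Memory k) (δ : ℕ) (others : Fin k → Option (Memory k))
    (winner : Option (Fin k)) : Memory k × Option ℤ :=
  match M.state with
  | .settled =>
      -- help the visitors; record those that come for the first time
      ({ M with
          visited := fun j => M.visited j || (others j).isSome
          entryPort := fun j =>
            match others j with
            | some N => if M.visited j then M.entryPort j else N.portEntered
            | none => M.entryPort j }, none)
  | .explore =>
      match dockedRobot others with
      | some D =>
          if D.visited i then
            ({ M with seen := true, parentPtr := D.entryPort i, state := .backtrack },
              some M.portEntered)
          else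
            forward δ { M with seen := false, parentPtr := M.portEntered }
      | none =>
          if winner = some i then
            -- dock, and record the robots that are present
            ({ M with
                state := .settled
                visited := fun j => (others j).isSome
                entryPort := fun j =>
                  match others j with
                  | some N => N.portEntered
                  | none => -1 }, none)
          else
            forward δ M
  | .backtrack =>
      match dockedRobot others with
      | some D =>
          let p := (M.portEntered + 1) % (δ : ℤ)
          ({ M with
              seen := D.visited i
              parentPtr := D.entryPort i
              portEntered := p
              state := if p ≠ D.entryPort i then .explore else .backtrack }, some p)
      | none => (M, none)

/-- A MUTEX: in every round, at every node, some robot among the contenders wins.  Which one is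
arbitrary. -/
abbrev Mutex (V : Type u) (k : ℕ) : Type u :=
  ℕ → V → (S : Finset (Fin k)) → S.Nonempty → S

/-- A configuration: the node of each robot, the port through which it entered this node (`-1` if
it has not moved yet), and its memory. -/
structure Config (V : Type u) (k : ℕ) where
  pos : Fin k → V
  entry : Fin k → ℤ
  mem : Fin k → Memory k

section

variable {V : Type u} [Fintype V] [DecidableEq V] {G : SimpleGraph V} [DecidableRel G.Adj]

/-- A move from `u` through port `p`: the node that is reached, and the port through which it is
entered.  If `u` has no port `p`, the robot stays where it is. -/
def traverse (ports : PortLabelling G) (u : V) (p : ℤ) : V × ℤ :=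
  if h : 0 ≤ p ∧ p < (G.degree u : ℤ) then
    let w := ports u ⟨p.toNat, by omega⟩
    (w.1, (((ports w.1).symm ⟨u, G.adj_symm w.2⟩ : Fin (G.degree w.1)) : ℕ))
  else (u, -1)

/-- Round `t`, executed simultaneously by all robots. -/
def round {k : ℕ} (ports : PortLabelling G) (mutex : Mutex V k) (t : ℕ) (c : Config V k) :
    Config V k :=
  let M : Fin k → Memory k := fun i => sense t (c.entry i) (c.mem i)
  let others : Fin k → Fin k → Option (Memory k) := fun i j =>
    if j ≠ i ∧ c.pos j = c.pos i then some (M j) else none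
  let contenders : V → Finset (Fin k) := fun v =>
    Finset.univ.filter fun j => c.pos j = v ∧ (M j).state = .explore
  let winner : V → Option (Fin k) := fun v =>
    if h : (contenders v).Nonempty then some (mutex t v (contenders v) h).1 else none
  let out : Fin k → Memory k × Option ℤ := fun i =>
    code i (M i) (G.degree (c.pos i)) (others i) (winner (c.pos i))
  let dest : Fin k → V × ℤ := fun i =>
    match (out i).2 with
    | some p => traverse ports (c.pos i) p
    | none => (c.pos i, c.entry i)
  { pos := fun i => (dest i).1
    entry := fun i => (dest i).2
    mem := fun i => (out i).1 }

/-- The last value `4m - 2(n-1)` of the round counter in the main loop. -/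
def loopBound (G : SimpleGraph V) [DecidableRel G.Adj] : ℕ :=
  4 * G.edgeFinset.card - 2 * (Fintype.card V - 1)

/-- The execution of the algorithm from the initial positions `start`: the configuration after the
rounds `0, …, t-1`, where the main loop runs over the rounds `0, 1, …, L` and the robots then halt
(`L = ⊤`: the main loop is infinite). -/
noncomputable def execution {k : ℕ} (ports : PortLabelling G) (start : Fin k → V)
    (mutex : Mutex V k) (L : ℕ∞) : ℕ → Config V k
  | 0 => { pos := start, entry := fun _ => -1, mem := fun _ => Memory.init k }
  | t + 1 =>
      open Classical in
      if (t : ℕ∞) ≤ L then round ports mutex t (execution ports start mutex L t)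
      else execution ports start mutex L t

end

/-- Robot `i` has docked. -/
def Config.Docked {V : Type u} {k : ℕ} (c : Config V k) (i : Fin k) : Prop :=
  (c.mem i).state = .settled

/-- The contents (label and variables) that the memory of a robot can have between two rounds, over
all executions of the algorithm by `k` robots on connected graphs of maximum degree `Δ` with at
least `k` nodes. -/
def memoryContents (k Δ : ℕ) : Set (Fin k × Memory k) :=
  {x | ∃ (V : Type u) (_ : Fintype V) (_ : DecidableEq V) (G : SimpleGraph V)
      (_ : DecidableRel G.Adj) (ports : PortLabelling G) (start : Fin k → V) (mutex : Mutex V k)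
      (L : ℕ∞) (t : ℕ), G.Connected ∧ G.maxDegree = Δ ∧ k ≤ Fintype.card V ∧
      (L = (loopBound G : ℕ∞) ∨ L = ⊤) ∧
      x.2 = (execution ports start mutex L t).mem x.1}

/-- The elements of `S` can be stored in `B` bits. -/
def FitsInBits {α : Type*} (S : Set α) (B : ℕ) : Prop :=
  ∃ enc : α → (Fin B → Bool), Set.InjOn enc S

end Dispersion

/-!
As long as a robot has not docked, what it does is independent of the other robots.  At every node
where it has acted there is a docked robot (an exploring robot that does not dock either met one or
lost the MUTEX to one), and the entries that this robot keeps for it are exactly the marks of a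
depth-first search: whether the node has been visited, and the port to its parent.  Hence the robot
moves like a single searcher that writes its marks on the nodes (`Walker`, `Tracks.step`).

The single searcher is analysed by induction on the number of unmarked nodes and on the number of
ports that remain at the current node (`searched`).  A searched port costs two moves, one out through
it and one back in through it, and a node `u` that gets marked meanwhile contributes `deg u - 1`
further searched ports, all but the one to its parent.  So searching `r` ports of a node takes
`2r + 2 ∑ (deg u - 1)` moves, the sum being over the nodes `u` marked in between.  The initial node
has no parent, all its ports are searched, and this takes `2 ∑ deg u - 2(n-1) = 4m - 2(n-1)` moves
in all.  The set of marked nodes is then closed under adjacency, so that it contains all nodes of a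
connected graph (`isSome_parent_of_connected`).

So a robot that has not docked after that many rounds has acted at every node, and there is a docked
robot at each of them.  Docked robots are at distinct nodes, so the robots outnumber the nodes
(`docked_of_le_card`).

For the memory, all port variables stay between `-1` and `Δ` (`execution_bounds`), so that the
possible contents embed into a finite type with at most `2 ^ O(k log Δ)` elements.
-/

namespace Dispersion

/-! ### The marks of a depth-first search -/

section Marks

variable {V : Type u}

/-- A single searcher that performs the depth-first search of the algorithm, together with the
marks that it has left: `parent v` is `none` as long as the searcher has not acted at `v`, and then
the port through which `v` was first entered (`-1` for the initial node).  `back` says whether the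
searcher is backtracking. -/
structure Walker (V : Type u) where
  pos : V
  entry : ℤ
  back : Bool
  parent : V → Option ℤ

/-- The searcher before its first move. -/
def Walker.init (v : V) : Walker V := ⟨v, -1, false, fun _ => none⟩

/-- The marks of the second search refine those of the first one, and the search has been completed
at the nodes that were marked in between: all their neighbours are marked. -/
def Extends (G : SimpleGraph V) (f g : V → Option ℤ) : Prop :=
  (∀ v a, f v = some a → g v = some a) ∧
    ∀ v, f v = none → (g v).isSome → ∀ w, G.Adj v w → (g w).isSome

theorem Extends.isSome {G : SimpleGraph V} {f g : V → Option ℤ} (h : Extends G f g) {v : V}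
    (hv : (f v).isSome) : (g v).isSome := by
  obtain ⟨a, ha⟩ := Option.isSome_iff_exists.1 hv
  simp [h.1 v a ha]

theorem Extends.refl {G : SimpleGraph V} (f : V → Option ℤ) : Extends G f f :=
  ⟨fun _ _ h => h, fun v h h' => by simp [h] at h'⟩

theorem Extends.trans {G : SimpleGraph V} {f g h : V → Option ℤ} (h₁ : Extends G f g)
    (h₂ : Extends G g h) : Extends G f h := by
  refine ⟨fun v a hv => h₂.1 v a (h₁.1 v a hv), fun v hf hh w hw => ?_⟩
  by_cases hg : (g v).isSome
  · exact h₂.isSome (h₁.2 v hf hg w hw)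
  · exact h₂.2 v (by simpa using hg) hh w hw

/-- The number of unmarked nodes. -/
def unmarkedCard [Fintype V] (f : V → Option ℤ) : ℕ :=
  (Finset.univ.filter fun v => f v = none).card

theorem Extends.unmarkedCard_le [Fintype V] {G : SimpleGraph V} {f g : V → Option ℤ}
    (h : Extends G f g) : unmarkedCard g ≤ unmarkedCard f := by
  apply Finset.card_le_card
  intro w hw
  simp only [Finset.mem_filter, Finset.mem_univ, true_and] at hw ⊢
  by_contra hf
  have := h.isSome (v := w) (by simpa [Option.isSome_iff_ne_none] using hf)
  simp [hw] at this

variable [DecidableEq V]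

theorem unmarkedCard_update_lt [Fintype V] {f : V → Option ℤ} {v : V} (h : f v = none) (a : ℤ) :
    unmarkedCard (Function.update f v (some a)) < unmarkedCard f := by
  apply Finset.card_lt_card
  refine Finset.ssubset_iff_of_subset ?_ |>.2 ⟨v, by simp [h], by simp⟩
  intro w hw
  by_cases hwv : w = v
  · simp [hwv] at hw
  · simpa [hwv] using hw

/-- The marks after the searcher has acted at its current node. -/
def Walker.mark (s : Walker V) : V → Option ℤ :=
  Function.update s.parent s.pos (some ((s.parent s.pos).getD s.entry))

theorem Walker.mark_of_ne (s : Walker V) {v : V} (h : v ≠ s.pos) : s.mark v = s.parent v := by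
  simp [Walker.mark, h]

theorem Walker.mark_pos (s : Walker V) :
    s.mark s.pos = some ((s.parent s.pos).getD s.entry) := by
  simp [Walker.mark]

theorem Walker.mark_of_some (s : Walker V) {v : V} {a : ℤ} (h : s.parent v = some a) :
    s.mark v = some a := by
  by_cases hv : v = s.pos
  · subst hv
    simp [Walker.mark, h]
  · rw [s.mark_of_ne hv, h]

theorem Walker.mark_eq_parent (s : Walker V) {a : ℤ} (h : s.parent s.pos = some a) :
    s.mark = s.parent := by
  rw [Walker.mark, h, Option.getD_some, ← h, Function.update_eq_self]

end Marks

/-! ### Depth-first search by a single searcher -/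

section Walk

variable {V : Type u} [Fintype V] [DecidableEq V] {G : SimpleGraph V} [DecidableRel G.Adj]

/-- The port at `v` of the edge from `v` to `w`. -/
def portTo (ports : PortLabelling G) {v w : V} (h : G.Adj v w) : ℤ :=
  (((ports v).symm ⟨w, h⟩ : Fin (G.degree v)) : ℕ)

theorem portTo_nonneg (ports : PortLabelling G) {v w : V} (h : G.Adj v w) : 0 ≤ portTo ports h :=
  Int.natCast_nonneg _

theorem portTo_lt (ports : PortLabelling G) {v w : V} (h : G.Adj v w) :
    portTo ports h < G.degree v :=
  Int.ofNat_lt.2 (Fin.is_lt _)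

theorem traverse_portTo (ports : PortLabelling G) {v w : V} (h : G.Adj v w) :
    traverse ports v (portTo ports h) = (w, portTo ports h.symm) := by
  have key : ∀ (p : Fin (G.degree v)) (x : G.neighborSet v), ports v p = x →
      traverse ports v ((p : ℕ) : ℤ) = (x.1, portTo ports (G.adj_symm x.2)) := by
    rintro p x rfl
    have h : 0 ≤ ((p : ℕ) : ℤ) ∧ ((p : ℕ) : ℤ) < (G.degree v : ℤ) := by
      have := p.2
      omega
    rw [traverse, dif_pos h]
    rfl
  exact key _ ⟨w, h⟩ (Equiv.apply_symm_apply _ _)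

/-- Traversing a valid port leads to a neighbour, and the port of entry there leads back. -/
theorem exists_traverse (ports : PortLabelling G) (v : V) {p : ℤ} (h0 : 0 ≤ p)
    (h1 : p < G.degree v) :
    ∃ (w : V) (q : ℤ), traverse ports v p = (w, q) ∧ G.Adj v w ∧ 0 ≤ q ∧ q < G.degree w ∧
      traverse ports w q = (v, p) := by
  lift p to ℕ using h0
  have h1' : p < G.degree v := by exact_mod_cast h1
  obtain ⟨⟨w, hw⟩, hp⟩ : ∃ x, ports v ⟨p, h1'⟩ = x := ⟨_, rfl⟩
  have hw' : G.Adj v w := hw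
  have hp' : (p : ℤ) = portTo ports hw' := by
    rw [portTo, ← hp, Equiv.symm_apply_apply]
  rw [hp']
  exact ⟨w, _, traverse_portTo ports hw', hw', portTo_nonneg ports hw'.symm,
    portTo_lt ports hw'.symm, traverse_portTo ports hw'.symm⟩

/-- Every neighbour of a node is reached through some port. -/
theorem exists_port_of_adj (ports : PortLabelling G) {v w : V} (h : G.Adj v w) :
    ∃ p : ℤ, 0 ≤ p ∧ p < G.degree v ∧ (traverse ports v p).1 = w :=
  ⟨portTo ports h, portTo_nonneg ports h, portTo_lt ports h, by rw [traverse_portTo ports h]⟩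

/-- One move of the searcher: an exploring searcher that enters a marked node turns round, and in
all other cases the searcher leaves through the next port. -/
def Walker.step (ports : PortLabelling G) (s : Walker V) : Walker V :=
  if s.back = false ∧ (s.parent s.pos).isSome then
    { pos := (traverse ports s.pos s.entry).1
      entry := (traverse ports s.pos s.entry).2
      back := true
      parent := s.mark }
  else
    let p := (s.entry + 1) % (G.degree s.pos : ℤ)
    { pos := (traverse ports s.pos p).1
      entry := (traverse ports s.pos p).2
      back := decide (p = (s.parent s.pos).getD s.entry)
      parent := s.mark }

theorem Walker.parent_step (ports : PortLabelling G) (s : Walker V) :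
    (s.step ports).parent = s.mark := by
  unfold Walker.step
  split_ifs <;> rfl

/-- The sum of `deg v - 1` over the marked nodes.  Twice its increase is the number of moves that
a search spends at the nodes that it marks. -/
def markedWeight (G : SimpleGraph V) [DecidableRel G.Adj] (f : V → Option ℤ) : ℤ :=
  ∑ v, if (f v).isSome then (G.degree v : ℤ) - 1 else 0

theorem markedWeight_update {f : V → Option ℤ} {v : V} (h : f v = none) (a : ℤ) :
    markedWeight G (Function.update f v (some a)) = markedWeight G f + (G.degree v - 1) := by
  unfold markedWeight
  rw [← Finset.add_sum_erase _ _ (Finset.mem_univ v),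
    ← Finset.add_sum_erase Finset.univ (fun v => if (f v).isSome then (G.degree v : ℤ) - 1 else 0)
      (Finset.mem_univ v)]
  have : ∀ w ∈ Finset.univ.erase v,
      (if (Function.update f v (some a) w).isSome then (G.degree w : ℤ) - 1 else 0) =
        if (f w).isSome then (G.degree w : ℤ) - 1 else 0 := by
    intro w hw
    rw [Function.update_of_ne (Finset.ne_of_mem_erase hw)]
  rw [Finset.sum_congr rfl this]
  simp [h]
  ring

/-- The state after `r` further ports of a marked node `v` have been searched, starting from a
backtracking searcher at `v` that came in through port `x`: the searcher has come back through the
last of them, and the number of moves is determined by the nodes marked in between. -/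
def Searched (ports : PortLabelling G) (v : V) (x : ℤ) (f : V → Option ℤ) (r : ℕ) : Prop :=
  ∃ (N : ℕ) (x' : ℤ) (g : V → Option ℤ),
    (Walker.step ports)^[N] ⟨v, x, true, f⟩ = ⟨v, x', true, g⟩ ∧
    x' ≡ x + r [ZMOD G.degree v] ∧ Extends G f g ∧
    (N : ℤ) = 2 * r + 2 * (markedWeight G g - markedWeight G f) ∧
    ∀ s : ℕ, 1 ≤ s → s ≤ r → (g (traverse ports v ((x + s) % G.degree v)).1).isSome

theorem Searched.zero (ports : PortLabelling G) (v : V) (x : ℤ) (f : V → Option ℤ) :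
    Searched ports v x f 0 := by
  refine ⟨0, x, f, rfl, by simp, Extends.refl f, by simp, fun s h1 h2 => by omega⟩

/-- The search of one port: either the neighbour is marked and the searcher bounces, or the
neighbour gets marked, all its other ports are searched, and the searcher returns. -/
theorem searched_one (ports : PortLabelling G) {v : V} {x a : ℤ} {f : V → Option ℤ}
    (hv : f v = some a) (hdeg : 0 < G.degree v) (ha : (x + 1) % (G.degree v : ℤ) ≠ a)
    (ih : ∀ (w : V) (y : ℤ), f w = none → 0 ≤ y → y < G.degree w →
      Searched ports w y (Function.update f w (some y)) (G.degree w - 1)) :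
    Searched ports v x f 1 := by
  have hd : (0 : ℤ) < G.degree v := by exact_mod_cast hdeg
  set p : ℤ := (x + 1) % (G.degree v : ℤ) with hp
  have hp0 : 0 ≤ p := Int.emod_nonneg _ hd.ne'
  have hp1 : p < G.degree v := Int.emod_lt_of_pos _ hd
  obtain ⟨w, y, hvw, hadj, hy0, hy1, hwv⟩ := exists_traverse ports v hp0 hp1
  have hstep : Walker.step ports ⟨v, x, true, f⟩ = ⟨w, y, false, f⟩ := by
    have hm := Walker.mark_eq_parent (⟨v, x, true, f⟩ : Walker V) hv
    simp [Walker.step, hm, ← hp, hvw, hv, ha]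
  have hmod : p ≡ x + (1 : ℕ) [ZMOD G.degree v] := by
    simpa [hp] using Int.mod_modEq (x + 1) (G.degree v)
  cases hw : f w with
  | some b =>
    have hm := Walker.mark_eq_parent (⟨w, y, false, f⟩ : Walker V) hw
    refine ⟨2, p, f, ?_, hmod, Extends.refl f, by simp, fun s h1 h2 => ?_⟩
    · rw [Function.iterate_succ_apply, hstep, Function.iterate_one]
      simp [Walker.step, hm, hwv, hw]
    · obtain rfl : s = 1 := by omega
      simp [← hp, hvw, hw]
  | none =>
    obtain ⟨N, x', g, hN, hx', hext, hcount, hnb⟩ := ih w y hw hy0 hy1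
    have hwd : (0 : ℤ) < G.degree w := by omega
    have hgw : g w = some y := hext.1 w y (by simp)
    have hgv : g v = some a := hext.1 v a (by
      rw [Function.update_of_ne hadj.ne, hv])
    -- on entering `w` for the first time, the searcher behaves as if it had marked `w` before
    have hfresh : Walker.step ports ⟨w, y, false, f⟩ =
        Walker.step ports ⟨w, y, true, Function.update f w (some y)⟩ := by
      simp [Walker.step, Walker.mark, hw]
    have hreturn : (x' + 1) % (G.degree w : ℤ) = y := by
      have h1 : x' + 1 ≡ y [ZMOD G.degree w] := by
        have h2 := hx'.add_right 1
        have h3 : y + ((G.degree w - 1 : ℕ) : ℤ) + 1 = y + G.degree w := by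
          have : 1 ≤ G.degree w := by omega
          push_cast [this]
          ring
        rw [h3] at h2
        exact h2.trans (by simp [Int.ModEq])
      rw [h1.eq, Int.emod_eq_of_lt hy0 hy1]
    have hlast : Walker.step ports ⟨w, x', true, g⟩ = ⟨v, p, true, g⟩ := by
      have hm := Walker.mark_eq_parent (⟨w, x', true, g⟩ : Walker V) hgw
      simp [Walker.step, hm, hreturn, hwv, hgw]
    have hextf : Extends G f g := by
      refine ⟨fun u b hu => hext.1 u b ?_, fun u hu hgu z hz => ?_⟩
      · rwa [Function.update_of_ne (fun h => by simp [h, hw] at hu)]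
      · by_cases huw : u = w
        · subst huw
          obtain ⟨q, hq0, hq1, hqz⟩ := exists_port_of_adj ports hz
          by_cases hqy : q = y
          · rw [← hqz, hqy, hwv]
            simp [hgv]
          · obtain ⟨s, hs⟩ := Int.eq_ofNat_of_zero_le (Int.emod_nonneg (q - y) hwd.ne')
            have hs1 : (q - y) % (G.degree u : ℤ) < G.degree u := Int.emod_lt_of_pos _ hwd
            have hsq : (y + s) % (G.degree u : ℤ) = q := by
              rw [← hs, Int.add_emod_emod, add_sub_cancel,
                Int.emod_eq_of_lt hq0 hq1]
            have hs0 : s ≠ 0 := by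
              rintro rfl
              simp only [Nat.cast_zero, add_zero] at hsq
              rw [Int.emod_eq_of_lt hy0 hy1] at hsq
              exact hqy hsq.symm
            have := hnb s (by omega) (by omega)
            rwa [hsq, hqz] at this
        · exact hext.2 u (by rw [Function.update_of_ne huw, hu]) hgu z hz
    refine ⟨N + 2, p, g, ?_, hmod, hextf, ?_, fun s h1 h2 => ?_⟩
    · rw [Function.iterate_succ_apply, hstep, Function.iterate_succ_apply, hfresh,
        ← Function.iterate_succ_apply, Function.iterate_succ_apply', hN, hlast]
    · rw [markedWeight_update hw] at hcount
      have : 1 ≤ G.degree w := by omega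
      push_cast [this] at hcount ⊢
      linarith
    · obtain rfl : s = 1 := by omega
      simp [← hp, hvw, hgw]

/-- Depth-first search from a marked node, as long as the port to the parent is not reached. -/
theorem searched (ports : PortLabelling G) (u : ℕ) :
    ∀ (r : ℕ) (v : V) (x a : ℤ) (f : V → Option ℤ), unmarkedCard f ≤ u → f v = some a →
      0 < G.degree v →
      (∀ s : ℕ, 1 ≤ s → s ≤ r → (x + s) % (G.degree v : ℤ) ≠ a) → Searched ports v x f r := by
  induction u using Nat.strong_induction_on with
  | _ u ihu =>
  intro r
  induction r with
  | zero => exact fun v x a f _ _ _ _ => Searched.zero ports v x f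
  | succ r ihr =>
    intro v x a f hu hv hdeg hs
    obtain ⟨N₁, y, g, hN₁, hy, hfg, hc₁, hnb₁⟩ := ihr v x a f hu hv hdeg
      (fun s h1 h2 => hs s h1 (by omega))
    have hgv := hfg.1 v a hv
    have hmod : ∀ s : ℕ, (y + s) % (G.degree v : ℤ) = (x + (r + s : ℕ)) % (G.degree v : ℤ) := by
      intro s
      have := hy.add_right s
      rw [this.eq]
      push_cast
      ring_nf
    obtain ⟨N₂, z, h, hN₂, hz, hgh, hc₂, hnb₂⟩ := searched_one ports (x := y) hgv hdeg
      (by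
        have := hs (r + 1) (by omega) le_rfl
        rw [← hmod 1] at this
        simpa using this)
      (by
        intro w b hw hb0 hb1
        have hlt := (unmarkedCard_update_lt hw b).trans_le (hfg.unmarkedCard_le.trans hu)
        refine ihu _ hlt _ w b b _ le_rfl (by simp) (by omega) ?_
        intro s h1 h2 heq
        -- the port of entry recurs only after `deg w` further ports
        have hdvd : (G.degree w : ℤ) ∣ s := by
          have h3 : b + s ≡ b + 0 [ZMOD G.degree w] := by
            simp only [Int.ModEq, heq, add_zero, Int.emod_eq_of_lt hb0 hb1]
          exact Int.modEq_zero_iff_dvd.1 (Int.ModEq.add_left_cancel' b h3)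
        have := Int.le_of_dvd (by omega) hdvd
        omega)
    refine ⟨N₁ + N₂, z, h, ?_, ?_, hfg.trans hgh, ?_, fun s h1 h2 => ?_⟩
    · rw [Nat.add_comm, Function.iterate_add_apply, hN₁, hN₂]
    · have := hz.trans (hy.add_right (1 : ℕ))
      simpa [add_assoc] using this
    · push_cast at *
      linarith
    · rcases Nat.lt_or_ge r s with hlt | hle
      · obtain rfl : s = r + 1 := by omega
        have := hnb₂ 1 le_rfl le_rfl
        rwa [hmod 1] at this
      · exact hgh.isSome (hnb₁ s h1 hle)

/-- In a connected graph with `m` edges and `n ≥ 2` nodes, the searcher has acted at every node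
after `4m - 2(n-1)` moves. -/
theorem isSome_parent_of_connected (ports : PortLabelling G) (hG : G.Connected)
    (hn : 2 ≤ Fintype.card V) (v₀ v : V) :
    (((Walker.step ports)^[loopBound G] (Walker.init v₀)).parent v).isSome := by
  have : Nontrivial V := Fintype.one_lt_card_iff_nontrivial.1 (by omega)
  have hdeg : ∀ v, 0 < G.degree v := fun v => hG.preconnected.degree_pos_of_nontrivial v
  have hd : (0 : ℤ) < G.degree v₀ := by exact_mod_cast hdeg v₀
  set f : V → Option ℤ := Function.update (fun _ => none) v₀ (some (-1)) with hf
  -- the value `-1` at the initial node is not a port, so all its ports are searched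
  obtain ⟨N, x, g, hN, -, hext, hcount, hnb⟩ := searched ports (unmarkedCard f) (G.degree v₀) v₀
    (-1) (-1) f le_rfl (by simp [hf]) (hdeg v₀) (fun s h1 h2 h => by
      have := Int.emod_nonneg (-1 + s : ℤ) hd.ne'
      omega)
  have hfresh : Walker.step ports (Walker.init v₀) = Walker.step ports ⟨v₀, -1, true, f⟩ := by
    simp [Walker.init, Walker.step, Walker.mark, hf]
  have hg₀ : (g v₀).isSome := hext.isSome (by simp [hf])
  have hclosed : ∀ v w, G.Adj v w → (g v).isSome → (g w).isSome := by
    intro v w hvw hv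
    by_cases hv₀ : v = v₀
    · subst hv₀
      obtain ⟨q, hq0, hq1, hqw⟩ := exists_port_of_adj ports hvw
      have := hnb (q.toNat + 1) (by omega) (by omega)
      have hq : (-1 + ((q.toNat + 1 : ℕ) : ℤ)) % (G.degree v : ℤ) = q := by
        rw [← Int.emod_eq_of_lt hq0 hq1]
        congr 1
        push_cast
        rw [Int.toNat_of_nonneg (Int.emod_nonneg _ hd.ne'), Int.emod_eq_of_lt hq0 hq1]
        ring
      rwa [hq, hqw] at this
    · exact hext.2 v (by simp [hf, hv₀]) hv w hvw
  have hwalk : ∀ {v w : V}, G.Walk v w → (g v).isSome → (g w).isSome := by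
    intro v w p
    induction p with
    | nil => exact id
    | cons h p ih => exact fun hv => ih (hclosed _ _ h hv)
  have hall : ∀ v, (g v).isSome := by
    intro v
    obtain ⟨p⟩ := hG.preconnected v₀ v
    exact hwalk p hg₀
  have hf' : markedWeight G f = G.degree v₀ - 1 := by
    rw [hf, markedWeight_update rfl]
    simp [markedWeight]
  have hg' : markedWeight G g = 2 * (G.edgeFinset.card : ℤ) - Fintype.card V := by
    have := G.sum_degrees_eq_twice_card_edges
    simp only [markedWeight, hall, if_true, Finset.sum_sub_distrib]
    rw [← Nat.cast_sum, this]
    simp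
  have hm : Fintype.card V ≤ 2 * G.edgeFinset.card := by
    rw [← G.sum_degrees_eq_twice_card_edges, Fintype.card_eq_sum_ones]
    exact Finset.sum_le_sum fun v _ => hdeg v
  have hN' : N = loopBound G := by
    unfold loopBound
    omega
  obtain ⟨N', hN''⟩ : ∃ N', N = N' + 1 := ⟨N - 1, by omega⟩
  rw [hN''] at hN
  rw [← hN', hN'', Function.iterate_succ_apply, hfresh, ← Function.iterate_succ_apply,
    Nat.succ_eq_add_one, hN]
  exact hall v

theorem loopBound_pos (ports : PortLabelling G) (hG : G.Connected) (hn : 2 ≤ Fintype.card V) :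
    0 < loopBound G := by
  obtain ⟨v⟩ := hG.nonempty
  rw [Nat.pos_iff_ne_zero]
  intro h0
  have := isSome_parent_of_connected ports hG hn v v
  simp [h0, Walker.init] at this

theorem traverse_traverse (ports : PortLabelling G) (v : V) (p : ℤ) :
    (traverse ports (traverse ports v p).1 (traverse ports v p).2).1 = v := by
  by_cases h : 0 ≤ p ∧ p < (G.degree v : ℤ)
  · obtain ⟨w, q, hw, -, -, -, hv⟩ := exists_traverse ports v h.1 h.2
    rw [hw, hv]
  · have : traverse ports v p = (v, -1) := by rw [traverse, dif_neg h]
    rw [this]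
    simp [traverse]

/-- The port to the parent of a marked node leads to a marked node, a searcher that comes from
elsewhere comes from a marked node, and a backtracking searcher is at a marked node. -/
structure Walker.Valid (ports : PortLabelling G) (s : Walker V) : Prop where
  parent : ∀ v a, s.parent v = some a → (s.parent (traverse ports v a).1).isSome
  entry : (traverse ports s.pos s.entry).1 = s.pos ∨
    (s.parent (traverse ports s.pos s.entry).1).isSome
  back : s.back = true → (s.parent s.pos).isSome

theorem Walker.valid_init (ports : PortLabelling G) (v : V) : (Walker.init v).Valid ports := by
  refine ⟨by simp [Walker.init], Or.inl ?_, by simp [Walker.init]⟩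
  simp [Walker.init, traverse]

theorem Walker.Valid.step {ports : PortLabelling G} {s : Walker V} (h : s.Valid ports) :
    (s.step ports).Valid ports := by
  have hmono : ∀ v, (s.parent v).isSome → (s.mark v).isSome := by
    intro v hv
    obtain ⟨a, ha⟩ := Option.isSome_iff_exists.1 hv
    simp [s.mark_of_some ha]
  have hpos : (s.mark s.pos).isSome := by simp [s.mark_pos]
  have hentry : (s.mark (traverse ports s.pos s.entry).1).isSome := by
    rcases h.entry with he | he
    · rwa [he]
    · exact hmono _ he
  have hparent : ∀ v a, s.mark v = some a → (s.mark (traverse ports v a).1).isSome := by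
    intro v a hv
    by_cases hvs : v = s.pos
    · subst hvs
      cases hp : s.parent s.pos with
      | none =>
        rw [s.mark_pos, hp, Option.getD_none, Option.some_inj] at hv
        rwa [← hv]
      | some b =>
        rw [s.mark_pos, hp, Option.getD_some, Option.some_inj] at hv
        exact hmono _ (h.parent _ _ (hv ▸ hp))
    · rw [s.mark_of_ne hvs] at hv
      exact hmono _ (h.parent _ _ hv)
  unfold Walker.step
  split_ifs with hb
  · exact ⟨hparent, Or.inr (by simpa only [traverse_traverse] using hpos), fun _ => hentry⟩
  · refine ⟨hparent, Or.inr (by simpa only [traverse_traverse] using hpos), fun hp => ?_⟩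
    refine hparent _ _ ?_
    rw [s.mark_pos, of_decide_eq_true hp]

theorem Walker.valid_iterate (ports : PortLabelling G) (v : V) (t : ℕ) :
    ((Walker.step ports)^[t] (Walker.init v)).Valid ports := by
  induction t with
  | zero => exact Walker.valid_init ports v
  | succ t ih =>
    rw [Function.iterate_succ_apply']
    exact ih.step

theorem Walker.exists_pos_of_isSome (ports : PortLabelling G) (v₀ v : V) (t : ℕ)
    (h : (((Walker.step ports)^[t] (Walker.init v₀)).parent v).isSome) :
    ∃ s < t, ((Walker.step ports)^[s] (Walker.init v₀)).pos = v := by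
  induction t with
  | zero => simp [Walker.init] at h
  | succ t ih =>
    rw [Function.iterate_succ_apply', Walker.parent_step] at h
    by_cases hv : v = ((Walker.step ports)^[t] (Walker.init v₀)).pos
    · exact ⟨t, t.lt_succ_self, hv.symm⟩
    · rw [Walker.mark_of_ne _ hv] at h
      obtain ⟨s, hs, hs'⟩ := ih h
      exact ⟨s, by omega, hs'⟩

end Walk

/-! ### One round of the algorithm -/

section Round

variable {V : Type u} {k : ℕ}

/-- The memory of robot `i` after it has sensed its port of entry in round `t`. -/
def sensed (t : ℕ) (c : Config V k) (i : Fin k) : Memory k :=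
  sense t (c.entry i) (c.mem i)

theorem sensed_state (t : ℕ) (c : Config V k) (i : Fin k) :
    (sensed t c i).state = (c.mem i).state := by
  unfold sensed sense
  split_ifs <;> rfl

theorem sensed_of_docked (t : ℕ) {c : Config V k} {i : Fin k} (h : c.Docked i) :
    sensed t c i = c.mem i := by
  have : (c.mem i).state = .settled := h
  simp [sensed, sense, this]

variable [DecidableEq V]

/-- What robot `i` learns from the robots at its node. -/
def companions (t : ℕ) (c : Config V k) (i j : Fin k) : Option (Memory k) :=
  if j ≠ i ∧ c.pos j = c.pos i then some (sensed t c j) else none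

theorem dockedRobot_companions_eq_some {t : ℕ} {c : Config V k} {i : Fin k} {D : Memory k}
    (h : dockedRobot (companions t c i) = some D) :
    ∃ j, c.pos j = c.pos i ∧ c.Docked j ∧ D = c.mem j := by
  obtain ⟨j, -, hj⟩ := List.exists_of_findSome?_eq_some h
  unfold companions at hj
  split_ifs at hj with h1
  · rw [Option.bind_some] at hj
    split_ifs at hj with h2
    have hd : c.Docked j := by rwa [sensed_state] at h2
    refine ⟨j, h1.2, hd, ?_⟩
    rw [← sensed_of_docked t hd]
    exact (Option.some_inj.1 hj).symm
  · simp at hj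

theorem dockedRobot_companions_eq_none {t : ℕ} {c : Config V k} {i : Fin k}
    (h : dockedRobot (companions t c i) = none) {j : Fin k} (hj : j ≠ i)
    (hpos : c.pos j = c.pos i) : ¬ c.Docked j := by
  intro hd
  have := List.findSome?_eq_none_iff.1 h j (List.mem_finRange j)
  have hs : (sensed t c j).state = .settled := by rw [sensed_state]; exact hd
  simp [companions, hj, hpos, hs] at this

/-- The robots that contend to dock at `v` in round `t`. -/
def contenders (t : ℕ) (c : Config V k) (v : V) : Finset (Fin k) :=
  Finset.univ.filter fun j => c.pos j = v ∧ (sensed t c j).state = .explore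

/-- The robot that wins the MUTEX at `v` in round `t`. -/
def mutexWinner (mutex : Mutex V k) (t : ℕ) (c : Config V k) (v : V) : Option (Fin k) :=
  if h : (contenders t c v).Nonempty then some (mutex t v (contenders t c v) h).1 else none

theorem mutexWinner_eq_some {mutex : Mutex V k} {t : ℕ} {c : Config V k} {v : V} {i : Fin k}
    (h : mutexWinner mutex t c v = some i) : c.pos i = v ∧ (c.mem i).state = .explore := by
  unfold mutexWinner at h
  split_ifs at h with h1
  have hmem := (mutex t v (contenders t c v) h1).2
  rw [Option.some_inj.1 h] at hmem
  simpa [contenders, sensed_state] using hmem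

theorem exists_mutexWinner (mutex : Mutex V k) (t : ℕ) {c : Config V k} {i : Fin k}
    (h : (c.mem i).state = .explore) : ∃ j, mutexWinner mutex t c (c.pos i) = some j := by
  have : (contenders t c (c.pos i)).Nonempty := ⟨i, by simp [contenders, sensed_state, h]⟩
  exact ⟨_, dif_pos this⟩

variable [Fintype V] {G : SimpleGraph V} [DecidableRel G.Adj]

/-- The new memory of robot `i` after round `t`, and the port through which it moves. -/
def outcome (G : SimpleGraph V) [DecidableRel G.Adj] (mutex : Mutex V k) (t : ℕ)
    (c : Config V k) (i : Fin k) : Memory k × Option ℤ :=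
  code i (sensed t c i) (G.degree (c.pos i)) (companions t c i)
    (mutexWinner mutex t c (c.pos i))

theorem round_mem (ports : PortLabelling G) (mutex : Mutex V k) (t : ℕ) (c : Config V k)
    (i : Fin k) : (round ports mutex t c).mem i = (outcome G mutex t c i).1 :=
  rfl

theorem round_of_some (ports : PortLabelling G) {mutex : Mutex V k} {t : ℕ} {c : Config V k}
    {i : Fin k} {p : ℤ} (h : (outcome G mutex t c i).2 = some p) :
    (round ports mutex t c).pos i = (traverse ports (c.pos i) p).1 ∧
      (round ports mutex t c).entry i = (traverse ports (c.pos i) p).2 := by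
  have key : ∀ o : Option ℤ, o = some p →
      (match o with
        | some p => traverse ports (c.pos i) p
        | none => (c.pos i, c.entry i)) = traverse ports (c.pos i) p := by
    rintro o rfl
    rfl
  exact ⟨congrArg Prod.fst (key _ h), congrArg Prod.snd (key _ h)⟩

theorem round_of_none (ports : PortLabelling G) {mutex : Mutex V k} {t : ℕ} {c : Config V k}
    {i : Fin k} (h : (outcome G mutex t c i).2 = none) :
    (round ports mutex t c).pos i = c.pos i ∧
      (round ports mutex t c).entry i = c.entry i := by
  have key : ∀ o : Option ℤ, o = none →
      (match o with
        | some p => traverse ports (c.pos i) p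
        | none => (c.pos i, c.entry i)) = (c.pos i, c.entry i) := by
    rintro o rfl
    rfl
  exact ⟨congrArg Prod.fst (key _ h), congrArg Prod.snd (key _ h)⟩

theorem outcome_of_docked (mutex : Mutex V k) (t : ℕ) {c : Config V k} {i : Fin k}
    (h : c.Docked i) :
    outcome G mutex t c i = ({ c.mem i with
          visited := fun j => (c.mem i).visited j || (companions t c i j).isSome
          entryPort := fun j =>
            match companions t c i j with
            | some N => if (c.mem i).visited j then (c.mem i).entryPort j else N.portEntered
            | none => (c.mem i).entryPort j }, none) := by
  have hs : (c.mem i).state = .settled := h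
  simp only [outcome, sensed_of_docked t h, code, hs]

theorem outcome_of_wins {mutex : Mutex V k} {t : ℕ} {c : Config V k} {i : Fin k}
    (hs : (c.mem i).state = .explore) (hn : dockedRobot (companions t c i) = none)
    (hw : mutexWinner mutex t c (c.pos i) = some i) :
    outcome G mutex t c i = ({ sensed t c i with
          state := .settled
          visited := fun j => (companions t c i j).isSome
          entryPort := fun j =>
            match companions t c i j with
            | some N => N.portEntered
            | none => -1 }, none) := by
  have hs' : (sensed t c i).state = .explore := by rw [sensed_state, hs]
  simp only [outcome, code, hs', hn, hw, if_true]

theorem forward_state_ne (δ : ℕ) (M : Memory k) : (forward δ M).1.state ≠ .settled := by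
  simp only [forward]
  split_ifs <;> simp

/-- A robot docks exactly if it explores, nobody has docked at its node, and it wins the MUTEX. -/
theorem docked_round_iff (ports : PortLabelling G) (mutex : Mutex V k) (t : ℕ) (c : Config V k)
    (i : Fin k) : (round ports mutex t c).Docked i ↔ c.Docked i ∨
      ((c.mem i).state = .explore ∧ dockedRobot (companions t c i) = none ∧
        mutexWinner mutex t c (c.pos i) = some i) := by
  constructor
  · intro h
    by_contra hcon
    push Not at hcon
    obtain ⟨hd, hw⟩ := hcon
    rw [Config.Docked, round_mem, outcome] at h
    cases hs : (c.mem i).state with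
    | settled => exact hd hs
    | explore =>
      have hs' : (sensed t c i).state = .explore := by rw [sensed_state, hs]
      simp only [code, hs'] at h
      cases hD : dockedRobot (companions t c i) with
      | some D =>
        simp only [hD] at h
        split_ifs at h
        exact forward_state_ne _ _ h
      | none =>
        simp only [hD, if_neg (hw hs hD)] at h
        exact forward_state_ne _ _ h
    | backtrack =>
      have hs' : (sensed t c i).state = .backtrack := by rw [sensed_state, hs]
      simp only [code, hs'] at h
      cases hD : dockedRobot (companions t c i) with
      | some D =>
        simp only [hD] at h
        split_ifs at h
      | none => simp [hD, hs'] at h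
  · rintro (h | ⟨h1, h2, h3⟩)
    · rw [Config.Docked, round_mem, outcome_of_docked mutex t h]
      exact h
    · rw [Config.Docked, round_mem, outcome_of_wins h1 h2 h3]

theorem round_pos_of_docked (ports : PortLabelling G) {mutex : Mutex V k} {t : ℕ}
    {c : Config V k} {i : Fin k} (h : (round ports mutex t c).Docked i) :
    (round ports mutex t c).pos i = c.pos i := by
  rcases (docked_round_iff ports mutex t c i).1 h with h | ⟨h1, h2, h3⟩
  · exact (round_of_none ports (by rw [outcome_of_docked mutex t h])).1
  · exact (round_of_none ports (by rw [outcome_of_wins h1 h2 h3])).1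

/-- At most one robot has docked at each node. -/
def DockedInjective (c : Config V k) : Prop :=
  ∀ i j, c.Docked i → c.Docked j → c.pos i = c.pos j → i = j

theorem DockedInjective.round {ports : PortLabelling G} {mutex : Mutex V k} {t : ℕ}
    {c : Config V k} (h : DockedInjective c) : DockedInjective (round ports mutex t c) := by
  intro i j hi hj hij
  rw [round_pos_of_docked ports hi, round_pos_of_docked ports hj] at hij
  rcases (docked_round_iff ports mutex t c i).1 hi with hi | ⟨hi1, hi2, hi3⟩ <;>
    rcases (docked_round_iff ports mutex t c j).1 hj with hj | ⟨hj1, hj2, hj3⟩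
  · exact h i j hi hj hij
  · by_contra hne
    exact dockedRobot_companions_eq_none hj2 hne hij hi
  · by_contra hne
    exact dockedRobot_companions_eq_none hi2 (Ne.symm hne) hij.symm hj
  · rw [hij, hj3] at hi3
    exact (Option.some_inj.1 hi3).symm

/-- The marks that the docked robots keep for robot `i`, and the position and phase of `i`, are
those of a single searcher. -/
structure Tracks (c : Config V k) (i : Fin k) (s : Walker V) : Prop where
  pos : c.pos i = s.pos
  entry : c.entry i = s.entry
  state : (c.mem i).state = if s.back then .backtrack else .explore
  visited : ∀ j, c.Docked j → (c.mem j).visited i = (s.parent (c.pos j)).isSome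
  entryPort : ∀ j a, c.Docked j → s.parent (c.pos j) = some a → (c.mem j).entryPort i = a
  docked : ∀ v, (s.parent v).isSome → ∃ j, c.Docked j ∧ c.pos j = v

theorem Tracks.step_walker {ports : PortLabelling G} {mutex : Mutex V k} {t : ℕ}
    {c : Config V k} {i : Fin k} {s : Walker V} (h : Tracks c i s) (hs : s.Valid ports)
    (hport : (sensed t c i).portEntered = c.entry i) (hptr : (sensed t c i).parentPtr = c.entry i)
    (hi : ¬ (round ports mutex t c).Docked i) :
    (round ports mutex t c).pos i = (s.step ports).pos ∧
      (round ports mutex t c).entry i = (s.step ports).entry ∧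
      ((round ports mutex t c).mem i).state =
        if (s.step ports).back then .backtrack else .explore := by
  rw [docked_round_iff] at hi
  push Not at hi
  obtain ⟨hd, hw⟩ := hi
  -- what the docked robot at the node, if there is one, tells robot `i`
  have hsome : ∀ D, dockedRobot (companions t c i) = some D →
      D.visited i = (s.parent s.pos).isSome ∧
        ∀ a, s.parent s.pos = some a → D.entryPort i = a := by
    intro D hD
    obtain ⟨j, hj, hjd, rfl⟩ := dockedRobot_companions_eq_some hD
    rw [← h.pos, ← hj]
    exact ⟨h.visited j hjd, fun a ha => h.entryPort j a hjd ha⟩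
  have hnone : (s.parent s.pos).isSome → dockedRobot (companions t c i) ≠ none := by
    intro hp hD
    obtain ⟨j, hj, hjp⟩ := h.docked _ hp
    have hji : j ≠ i := fun hji => hd (hji ▸ hj)
    exact dockedRobot_companions_eq_none hD hji (hjp.trans h.pos.symm) hj
  have hdeg : G.degree (c.pos i) = G.degree s.pos := by rw [h.pos]
  have move : ∀ p, (outcome G mutex t c i).2 = some p → (s.step ports).pos =
      (traverse ports s.pos p).1 → (s.step ports).entry = (traverse ports s.pos p).2 →
      (outcome G mutex t c i).1.state = (if (s.step ports).back then .backtrack else .explore) →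
      (round ports mutex t c).pos i = (s.step ports).pos ∧
      (round ports mutex t c).entry i = (s.step ports).entry ∧
      ((round ports mutex t c).mem i).state =
        if (s.step ports).back then .backtrack else .explore := by
    intro p hp h1 h2 h3
    obtain ⟨h4, h5⟩ := round_of_some ports hp
    rw [h4, h5, h1, h2, round_mem, h3, h.pos]
    exact ⟨rfl, rfl, rfl⟩
  have hstate : (sensed t c i).state = if s.back then .backtrack else .explore := by
    rw [sensed_state, h.state]
  cases hb : s.back with
  | true =>
    have hmarked := hs.back hb
    obtain ⟨a, ha⟩ := Option.isSome_iff_exists.1 hmarked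
    obtain ⟨D, hD⟩ := Option.ne_none_iff_exists'.1 (hnone hmarked)
    have hDa := (hsome D hD).2 a ha
    have hout : outcome G mutex t c i =
        ({ sensed t c i with
            seen := D.visited i
            parentPtr := a
            portEntered := (s.entry + 1) % (G.degree s.pos : ℤ)
            state := if (s.entry + 1) % (G.degree s.pos : ℤ) ≠ a then .explore else .backtrack },
          some ((s.entry + 1) % (G.degree s.pos : ℤ))) := by
      simp only [hb, if_true] at hstate
      simp only [outcome, code, hstate, hD, hport, hDa, h.entry, hdeg]
    refine move _ (by rw [hout]) (by simp [Walker.step, hb]) (by simp [Walker.step, hb]) ?_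
    rw [hout]
    simp [Walker.step, hb, ha, ite_not]
  | false =>
    simp only [hb, Bool.false_eq_true, if_false] at hstate
    cases hp : s.parent s.pos with
    | some a =>
      obtain ⟨D, hD⟩ := Option.ne_none_iff_exists'.1 (hnone (by simp [hp]))
      have hDv := (hsome D hD).1
      rw [hp, Option.isSome_some] at hDv
      have hout : outcome G mutex t c i =
          ({ sensed t c i with
              seen := true
              parentPtr := D.entryPort i
              state := .backtrack }, some s.entry) := by
        simp only [outcome, code, hstate, hD, hDv, if_true, hport, h.entry]
      refine move _ (by rw [hout]) (by simp [Walker.step, hb, hp])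
        (by simp [Walker.step, hb, hp]) ?_
      rw [hout]
      simp [Walker.step, hb, hp]
    | none =>
      have hout : ∃ M : Memory k, M.portEntered = s.entry ∧ M.parentPtr = s.entry ∧
          outcome G mutex t c i = forward (G.degree s.pos) M := by
        cases hD : dockedRobot (companions t c i) with
        | some D =>
          have hDv := (hsome D hD).1
          rw [hp, Option.isSome_none] at hDv
          refine ⟨{ sensed t c i with seen := false, parentPtr := (sensed t c i).portEntered },
            ?_, ?_, ?_⟩
          · simp only [hport, h.entry]
          · simp only [hport, h.entry]
          · simp only [outcome, code, hstate, hD, hDv, Bool.false_eq_true, if_false, hdeg]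
        | none =>
          refine ⟨sensed t c i, by rw [hport, h.entry], by rw [hptr, h.entry], ?_⟩
          have := hw (by rw [← sensed_state t, hstate]) hD
          simp only [outcome, code, hstate, hD, if_neg this, hdeg]
      obtain ⟨M, hM1, hM2, hout⟩ := hout
      refine move ((s.entry + 1) % (G.degree s.pos : ℤ)) ?_ (by simp [Walker.step, hp])
        (by simp [Walker.step, hp]) ?_
      · rw [hout, forward, hM1]
      · rw [hout]
        simp [forward, Walker.step, hp, hM1, hM2]

/-- As long as robot `i` has not docked, it moves like a single searcher. -/
theorem Tracks.step {ports : PortLabelling G} {mutex : Mutex V k} {t : ℕ}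
    {c : Config V k} {i : Fin k} {s : Walker V} (h : Tracks c i s) (hs : s.Valid ports)
    (hport : (sensed t c i).portEntered = c.entry i) (hptr : (sensed t c i).parentPtr = c.entry i)
    (hi : ¬ (round ports mutex t c).Docked i) :
    Tracks (round ports mutex t c) i (s.step ports) := by
  obtain ⟨h1, h2, h3⟩ := h.step_walker hs hport hptr hi
  have hid : ¬ c.Docked i := fun hd => hi ((docked_round_iff ports mutex t c i).2 (Or.inl hd))
  have hcomp : ∀ j, j ≠ i → companions t c j i =
      if c.pos j = s.pos then some (sensed t c i) else none := by
    intro j hj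
    simp [companions, hj.symm, h.pos, eq_comm]
  -- where a robot docks, nobody has docked before, hence `i` has left no mark
  have hnew : ∀ j, ¬ c.Docked j → dockedRobot (companions t c j) = none →
      s.parent (c.pos j) = none := by
    intro j hj hD
    by_contra hp
    obtain ⟨l, hl, hlp⟩ := h.docked _ (Option.isSome_iff_ne_none.2 hp)
    exact dockedRobot_companions_eq_none hD (fun hlj => hj (hlj ▸ hl)) hlp hl
  have hexp : ∀ j, (c.mem j).state = .explore → ¬ c.Docked j := by
    intro j hj hd
    rw [Config.Docked, hj] at hd
    cases hd
  refine ⟨h1, h2, h3, fun j hj => ?_, fun j a hj ha => ?_, fun v hv => ?_⟩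
  · have hji : j ≠ i := fun hji => hi (hji ▸ hj)
    rw [Walker.parent_step, round_pos_of_docked ports hj, round_mem]
    rcases (docked_round_iff ports mutex t c j).1 hj with hjd | ⟨hj1, hj2, hj3⟩
    · rw [outcome_of_docked mutex t hjd]
      by_cases hpos : c.pos j = s.pos
      · simp [hcomp j hji, hpos, s.mark_pos]
      · simp [hcomp j hji, hpos, s.mark_of_ne hpos, h.visited j hjd]
    · rw [outcome_of_wins hj1 hj2 hj3]
      by_cases hpos : c.pos j = s.pos
      · simp [hcomp j hji, hpos, s.mark_pos]
      · simp [hcomp j hji, hpos, s.mark_of_ne hpos, hnew j (hexp j hj1) hj2]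
  · have hji : j ≠ i := fun hji => hi (hji ▸ hj)
    rw [Walker.parent_step, round_pos_of_docked ports hj] at ha
    rw [round_mem]
    rcases (docked_round_iff ports mutex t c j).1 hj with hjd | ⟨hj1, hj2, hj3⟩
    · rw [outcome_of_docked mutex t hjd]
      have hvis := h.visited j hjd
      by_cases hpos : c.pos j = s.pos
      · rw [hpos] at hvis ha
        rw [s.mark_pos, Option.some_inj] at ha
        cases hp : s.parent s.pos with
        | none =>
          rw [hp, Option.isSome_none] at hvis
          rw [hp, Option.getD_none] at ha
          simp [hcomp j hji, hpos, hvis, hport, h.entry, ha]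
        | some b =>
          rw [hp, Option.isSome_some] at hvis
          rw [hp, Option.getD_some] at ha
          simp [hcomp j hji, hpos, hvis, h.entryPort j b hjd (by rw [hpos, hp]), ha]
      · rw [s.mark_of_ne hpos] at ha
        simp [hcomp j hji, hpos, h.entryPort j a hjd ha]
    · rw [outcome_of_wins hj1 hj2 hj3]
      have hn := hnew j (hexp j hj1) hj2
      by_cases hpos : c.pos j = s.pos
      · rw [hpos] at hn ha
        rw [s.mark_pos, hn, Option.getD_none, Option.some_inj] at ha
        simp [hcomp j hji, hpos, hport, h.entry, ha]
      · rw [s.mark_of_ne hpos, hn] at ha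
        cases ha
  · rw [Walker.parent_step] at hv
    have hold : ∀ j, c.Docked j → c.pos j = v →
        ∃ j, (round ports mutex t c).Docked j ∧ (round ports mutex t c).pos j = v := by
      intro j hj hjv
      have hj' := (docked_round_iff ports mutex t c j).2 (Or.inl hj)
      exact ⟨j, hj', (round_pos_of_docked ports hj').trans hjv⟩
    by_cases hp : (s.parent v).isSome
    · obtain ⟨j, hj, hjv⟩ := h.docked v hp
      exact hold j hj hjv
    · have hvs : v = s.pos := by
        by_contra hne
        exact hp (s.mark_of_ne hne ▸ hv)
      have hback : s.back = false := by
        by_contra hb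
        exact hp (hvs ▸ hs.back (by simpa using hb))
      have hstate := h.state
      rw [hback, if_neg Bool.false_ne_true] at hstate
      have hvi : c.pos i = v := h.pos.trans hvs.symm
      cases hD : dockedRobot (companions t c i) with
      | some D =>
        obtain ⟨j, hj, hjd, -⟩ := dockedRobot_companions_eq_some hD
        exact hold j hjd (hj.trans hvi)
      | none =>
        obtain ⟨j, hj⟩ := exists_mutexWinner mutex t hstate
        obtain ⟨hjp, hjs⟩ := mutexWinner_eq_some hj
        have hjD : dockedRobot (companions t c j) = none := by
          by_contra hjD
          obtain ⟨D, hD'⟩ := Option.ne_none_iff_exists'.1 hjD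
          obtain ⟨l, hl, hld, -⟩ := dockedRobot_companions_eq_some hD'
          exact dockedRobot_companions_eq_none hD (fun hli => hid (hli ▸ hld))
            (hl.trans hjp) hld
        have hj' := (docked_round_iff ports mutex t c j).2 (Or.inr ⟨hjs, hjD, hjp ▸ hj⟩)
        exact ⟨j, hj', (round_pos_of_docked ports hj').trans (hjp.trans hvi)⟩

end Round

/-! ### Executions and dispersion -/

section Execution

theorem le_of_le_loopBound {V : Type u} [Fintype V] {G : SimpleGraph V} [DecidableRel G.Adj]
    {L : ℕ∞} {T : ℕ} (hL : L = (loopBound G : ℕ∞) ∨ L = ⊤)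
    (hT : T ≤ loopBound G) : (T : ℕ∞) ≤ L := by
  rcases hL with rfl | rfl
  · exact_mod_cast hT
  · exact le_top

variable {V : Type u} [Fintype V] [DecidableEq V] {G : SimpleGraph V} [DecidableRel G.Adj] {k : ℕ}
  (ports : PortLabelling G) (start : Fin k → V) (mutex : Mutex V k) {L : ℕ∞}

theorem execution_succ {t : ℕ} (h : (t : ℕ∞) ≤ L) :
    execution ports start mutex L (t + 1) =
      round ports mutex t (execution ports start mutex L t) := by
  rw [execution, if_pos h]

theorem execution_succ_of_lt {t : ℕ} (h : ¬ (t : ℕ∞) ≤ L) :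
    execution ports start mutex L (t + 1) = execution ports start mutex L t := by
  rw [execution, if_neg h]

theorem dockedInjective_execution (t : ℕ) :
    DockedInjective (execution ports start mutex L t) := by
  induction t with
  | zero =>
    intro i j hi
    cases hi
  | succ t ih =>
    by_cases h : (t : ℕ∞) ≤ L
    · rw [execution_succ ports start mutex h]
      exact ih.round
    · rwa [execution_succ_of_lt ports start mutex h]

/-- A docked robot remains docked and never moves. -/
theorem docked_execution_mono {s t : ℕ} (hst : s ≤ t) {i : Fin k}
    (h : (execution ports start mutex L s).Docked i) :
    (execution ports start mutex L t).Docked i ∧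
      (execution ports start mutex L t).pos i = (execution ports start mutex L s).pos i := by
  induction t, hst using Nat.le_induction with
  | base => exact ⟨h, rfl⟩
  | succ t hst ih =>
    by_cases ht : (t : ℕ∞) ≤ L
    · rw [execution_succ ports start mutex ht]
      have hd := (docked_round_iff ports mutex t _ i).2 (Or.inl ih.1)
      exact ⟨hd, (round_pos_of_docked ports hd).trans ih.2⟩
    · rwa [execution_succ_of_lt ports start mutex ht]

/-- After sensing, the port variables of a robot that has not docked hold its port of entry. -/
theorem sensed_ports (t : ℕ) {i : Fin k} (h : ¬ (execution ports start mutex L t).Docked i) :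
    (sensed t (execution ports start mutex L t) i).portEntered =
        (execution ports start mutex L t).entry i ∧
      (sensed t (execution ports start mutex L t) i).parentPtr =
        (execution ports start mutex L t).entry i := by
  cases t with
  | zero => exact ⟨rfl, rfl⟩
  | succ t =>
    have : ((execution ports start mutex L (t + 1)).mem i).state ≠ .settled := h
    simp [sensed, sense, this]

theorem tracks_execution (t : ℕ) (hL : ∀ s < t, (s : ℕ∞) ≤ L) {i : Fin k}
    (h : ¬ (execution ports start mutex L t).Docked i) :
    Tracks (execution ports start mutex L t) i
      ((Walker.step ports)^[t] (Walker.init (start i))) := by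
  induction t with
  | zero =>
    refine ⟨rfl, rfl, rfl, fun j hj => ?_, fun j a hj => ?_, fun v hv => ?_⟩
    · cases hj
    · cases hj
    · simp [Walker.init] at hv
  | succ t ih =>
    have hd : ¬ (execution ports start mutex L t).Docked i := fun hd =>
      h (docked_execution_mono ports start mutex t.le_succ hd).1
    obtain ⟨h1, h2⟩ := sensed_ports ports start mutex t hd
    rw [execution_succ ports start mutex (hL t t.lt_succ_self)] at h ⊢
    rw [Function.iterate_succ_apply']
    exact (ih (fun s hs => hL s (by omega)) hd).step (Walker.valid_iterate ports _ t) h1 h2 h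

/-- The single searcher has acted at every node after `4m - 2(n-1)` moves, or one move if there is
only one node. -/
theorem isSome_parent_of_max_le (hG : G.Connected) (v₀ v : V) :
    (((Walker.step ports)^[max 1 (loopBound G)] (Walker.init v₀)).parent v).isSome := by
  rcases Nat.lt_or_ge 1 (Fintype.card V) with hn | hn
  · rw [max_eq_right (loopBound_pos ports hG hn)]
    exact isSome_parent_of_connected ports hG hn v₀ v
  · have : Subsingleton V := Fintype.card_le_one_iff_subsingleton.1 hn
    have hm : G.edgeFinset.card = 0 := by
      rw [Finset.card_eq_zero, SimpleGraph.edgeFinset_eq_empty]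
      exact Subsingleton.elim _ _
    have hl : loopBound G = 0 := by simp [loopBound, hm]
    rw [hl, max_eq_left (Nat.zero_le 1), Function.iterate_one, Walker.parent_step,
      Subsingleton.elim v (Walker.init v₀).pos, Walker.mark_pos]
    rfl

/-- A robot that has not docked within `4m - 2(n-1)` rounds has visited every node. -/
theorem exists_pos_of_not_docked (hG : G.Connected) (hL : L = (loopBound G : ℕ∞) ∨ L = ⊤)
    {i : Fin k} (hi : ¬ (execution ports start mutex L (loopBound G)).Docked i) (v : V) :
    ∃ t ≤ loopBound G, (execution ports start mutex L t).pos i = v := by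
  obtain ⟨s, hs, hsv⟩ := Walker.exists_pos_of_isSome ports (start i) v _
    (isSome_parent_of_max_le ports hG (start i) v)
  have hs' : s ≤ loopBound G := by omega
  refine ⟨s, hs', ?_⟩
  rw [← hsv]
  refine (tracks_execution ports start mutex s
    (fun r hr => le_of_le_loopBound hL (by omega)) fun hd => hi ?_).pos
  exact (docked_execution_mono ports start mutex hs' hd).1

/-- If there are at most as many robots as nodes, then every robot docks: otherwise it would have
left a mark at every node, so that a robot would have docked at every node. -/
theorem docked_of_le_card (hG : G.Connected) (hL : L = (loopBound G : ℕ∞) ∨ L = ⊤)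
    (hk : k ≤ Fintype.card V) (i : Fin k) :
    (execution ports start mutex L (max 1 (loopBound G))).Docked i := by
  by_contra hi
  have htr := tracks_execution ports start mutex _ (fun s hs => le_of_le_loopBound hL (by omega)) hi
  choose f hf hfv using fun v =>
    htr.docked v (isSome_parent_of_max_le ports hG (start i) v)
  have hinj : Function.Injective f := fun v w hvw => by rw [← hfv v, hvw, hfv w]
  have hbij : Function.Bijective f := by
    rw [Fintype.bijective_iff_injective_and_card]
    refine ⟨hinj, le_antisymm (Fintype.card_le_of_injective f hinj) ?_⟩
    simpa using hk
  obtain ⟨v, hv⟩ := hbij.2 i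
  exact hi (hv ▸ hf v)

end Execution

/-! ### The memory of a robot -/

section Storage

/-- All port variables have values between `-1` and `Δ`. -/
structure Memory.PortsLE {k : ℕ} (Δ : ℕ) (M : Memory k) : Prop where
  portEntered : M.portEntered ∈ Set.Icc (-1 : ℤ) Δ
  parentPtr : M.parentPtr ∈ Set.Icc (-1 : ℤ) Δ
  entryPort : ∀ j, M.entryPort j ∈ Set.Icc (-1 : ℤ) Δ

theorem neg_one_mem_Icc (Δ : ℕ) : (-1 : ℤ) ∈ Set.Icc (-1 : ℤ) Δ :=
  ⟨le_rfl, by omega⟩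

/-- The next port is in range.  For `δ = 0` the remainder is `p + 1` itself. -/
theorem next_port_mem_Icc {p : ℤ} {δ Δ : ℕ} (hδ : δ ≤ Δ) (h0 : -1 ≤ p) (h1 : p < Δ) :
    (p + 1) % (δ : ℤ) ∈ Set.Icc (-1 : ℤ) Δ := by
  rcases Nat.eq_zero_or_pos δ with rfl | hpos
  · simp only [Nat.cast_zero, Int.emod_zero, Set.mem_Icc]
    omega
  · have h2 := Int.emod_nonneg (p + 1) (b := (δ : ℤ)) (by omega)
    have h3 := Int.emod_lt_of_pos (p + 1) (b := (δ : ℤ)) (by omega)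
    constructor <;> omega

theorem Memory.PortsLE.forward {k δ Δ : ℕ} {M : Memory k} (h : M.PortsLE Δ) (hδ : δ ≤ Δ)
    (hp : M.portEntered < Δ) : (forward δ M).1.PortsLE Δ :=
  ⟨next_port_mem_Icc hδ h.portEntered.1 hp, h.parentPtr, h.entryPort⟩

theorem Memory.PortsLE.of_dockedRobot {k Δ : ℕ} {others : Fin k → Option (Memory k)}
    {D : Memory k} (ho : ∀ j N, others j = some N → N.PortsLE Δ)
    (h : dockedRobot others = some D) : D.PortsLE Δ := by
  obtain ⟨j, -, hj⟩ := List.exists_of_findSome?_eq_some h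
  obtain ⟨N, hN, hD⟩ := Option.bind_eq_some_iff.1 hj
  split_ifs at hD
  exact Option.some_inj.1 hD ▸ ho j N hN

theorem Memory.PortsLE.code {k δ Δ : ℕ} {i : Fin k} {M : Memory k}
    {others : Fin k → Option (Memory k)} {winner : Option (Fin k)} (h : M.PortsLE Δ)
    (hδ : δ ≤ Δ) (hp : M.state ≠ .settled → M.portEntered < Δ)
    (ho : ∀ j N, others j = some N → N.PortsLE Δ) :
    (code i M δ others winner).1.PortsLE Δ := by
  cases hs : M.state with
  | settled =>
    simp only [Dispersion.code, hs]
    refine ⟨h.portEntered, h.parentPtr, fun j => ?_⟩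
    cases hj : others j with
    | none => simpa [hj] using h.entryPort j
    | some N =>
      simp only [hj]
      split_ifs
      · exact h.entryPort j
      · exact (ho j N hj).portEntered
  | explore =>
    have hp' := hp (by simp [hs])
    simp only [Dispersion.code, hs]
    cases hD : dockedRobot others with
    | some D =>
      simp only
      split_ifs
      · exact ⟨h.portEntered, (Memory.PortsLE.of_dockedRobot ho hD).entryPort i, h.entryPort⟩
      · exact Memory.PortsLE.forward ⟨h.portEntered, h.portEntered, h.entryPort⟩ hδ hp'
    | none =>
      simp only
      split_ifs
      · refine ⟨h.portEntered, h.parentPtr, fun j => ?_⟩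
        cases hj : others j with
        | none => simp [hj]
        | some N => simpa [hj] using (ho j N hj).portEntered
      · exact h.forward hδ hp'
  | backtrack =>
    have hp' := hp (by simp [hs])
    simp only [Dispersion.code, hs]
    cases hD : dockedRobot others with
    | some D =>
      exact ⟨next_port_mem_Icc hδ h.portEntered.1 hp',
        (Memory.PortsLE.of_dockedRobot ho hD).entryPort i, h.entryPort⟩
    | none => exact h

theorem traverse_entry_bounds {V : Type u} [Fintype V] [DecidableEq V] {G : SimpleGraph V}
    [DecidableRel G.Adj] (ports : PortLabelling G) (v : V) (p : ℤ) :
    -1 ≤ (traverse ports v p).2 ∧ (traverse ports v p).2 < G.maxDegree := by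
  by_cases h : 0 ≤ p ∧ p < (G.degree v : ℤ)
  · obtain ⟨w, q, hw, -, hq0, hq1, -⟩ := exists_traverse ports v h.1 h.2
    have := G.degree_le_maxDegree w
    rw [hw]
    constructor <;> simp only <;> omega
  · rw [traverse, dif_neg h]
    constructor <;> simp only <;> omega

theorem execution_bounds {V : Type u} [Fintype V] [DecidableEq V] {G : SimpleGraph V}
    [DecidableRel G.Adj] {k : ℕ} (ports : PortLabelling G) (start : Fin k → V)
    (mutex : Mutex V k) {L : ℕ∞} (t : ℕ) (i : Fin k) :
    (-1 ≤ (execution ports start mutex L t).entry i ∧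
      (execution ports start mutex L t).entry i < G.maxDegree) ∧
      ((execution ports start mutex L t).mem i).PortsLE G.maxDegree := by
  induction t generalizing i with
  | zero =>
    have h := neg_one_mem_Icc G.maxDegree
    exact ⟨⟨le_rfl, by simp only [execution]; omega⟩, h, h, fun _ => h⟩
  | succ t ih =>
    by_cases ht : (t : ℕ∞) ≤ L
    · rw [execution_succ ports start mutex ht]
      set c := execution ports start mutex L t with hc
      have hsensed : ∀ j, (sensed t c j).PortsLE G.maxDegree := by
        intro j
        obtain ⟨⟨h1, h2⟩, h3⟩ := ih j
        unfold sensed sense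
        split_ifs
        · exact ⟨⟨h1, h2.le⟩, ⟨h1, h2.le⟩, h3.entryPort⟩
        · exact h3
      constructor
      · cases ho : (outcome G mutex t c i).2 with
        | some p =>
          rw [(round_of_some ports ho).2]
          exact traverse_entry_bounds ports _ _
        | none =>
          rw [(round_of_none ports ho).2]
          exact (ih i).1
      · rw [round_mem]
        refine (hsensed i).code (G.degree_le_maxDegree _) (fun hs => ?_) (fun j N hj => ?_)
        · rw [sensed_state] at hs
          rw [hc, (sensed_ports ports start mutex t hs).1]
          exact (ih i).1.2
        · unfold companions at hj
          split_ifs at hj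
          exact Option.some_inj.1 hj ▸ hsensed j
    · rw [execution_succ_of_lt ports start mutex ht]
      exact ih i

theorem FitsInBits.of_injOn {α β : Type*} [Fintype β] {S : Set α} {B : ℕ} (g : α → β)
    (hg : Set.InjOn g S) (hB : Fintype.card β ≤ 2 ^ B) : FitsInBits S B := by
  obtain ⟨e⟩ : Nonempty (β ↪ (Fin B → Bool)) :=
    Function.Embedding.nonempty_of_card_le (by simpa using hB)
  exact ⟨e ∘ g, e.injective.comp_injOn hg⟩

/-- A port variable with values between `-1` and `Δ`, as one of `Δ + 2` values. -/
def portCode (Δ : ℕ) (p : ℤ) : Fin (Δ + 2) :=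
  Fin.ofNat (Δ + 2) (p + 1).toNat

theorem portCode_injOn (Δ : ℕ) : Set.InjOn (portCode Δ) (Set.Icc (-1 : ℤ) Δ) := by
  rintro p ⟨hp0, hp1⟩ q ⟨hq0, hq1⟩ h
  have h' := congrArg Fin.val h
  simp only [portCode, Fin.ofNat] at h'
  rw [Nat.mod_eq_of_lt (by omega), Nat.mod_eq_of_lt (by omega)] at h'
  omega

/-- The label and the variables of a robot, as an element of a finite type. -/
def memoryCode (k Δ : ℕ) (x : Fin k × Memory k) :
    Fin k × (Fin (Δ + 2) × Fin (Δ + 2)) × (Bool × Bool) × Bool × (Fin k → Bool) ×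
      (Fin k → Fin (Δ + 2)) :=
  (x.1, (portCode Δ x.2.portEntered, portCode Δ x.2.parentPtr),
    (decide (x.2.state = .settled), decide (x.2.state = .explore)), x.2.seen, x.2.visited,
    fun j => portCode Δ (x.2.entryPort j))

theorem memoryCode_injOn (k Δ : ℕ) :
    Set.InjOn (memoryCode k Δ) {x | x.2.PortsLE Δ} := by
  rintro ⟨i, M⟩ hM ⟨j, N⟩ hN h
  simp only [memoryCode, Prod.mk.injEq] at h
  obtain ⟨rfl, ⟨h1, h2⟩, ⟨h3, h4⟩, h5, h6, h7⟩ := h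
  obtain ⟨p, q, s, b, vis, ent⟩ := M
  obtain ⟨p', q', s', b', vis', ent'⟩ := N
  have hp : p = p' := portCode_injOn Δ hM.portEntered hN.portEntered h1
  have hq : q = q' := portCode_injOn Δ hM.parentPtr hN.parentPtr h2
  have hent : ent = ent' := funext fun l =>
    portCode_injOn Δ (hM.entryPort l) (hN.entryPort l) (congrFun h7 l)
  have hs : s = s' := by
    cases s <;> cases s' <;> simp at h3 h4 <;> rfl
  simp only at h5 h6
  subst hp hq hent hs h5 h6
  rfl

theorem memoryContents_fitsInBits (k Δ b : ℕ) (hb : Δ + 2 ≤ 2 ^ b) :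
    FitsInBits (memoryContents.{u} k Δ) (k + (b + b) + (1 + 1) + 1 + k + b * k) := by
  refine FitsInBits.of_injOn (memoryCode k Δ) ((memoryCode_injOn k Δ).mono ?_) ?_
  · rintro x ⟨V, _, _, G, _, ports, start, mutex, L, t, -, hΔ, -, -, hx⟩
    have := (execution_bounds ports start mutex (L := L) t x.1).2
    rw [hΔ, ← hx] at this
    exact this
  · simp only [Fintype.card_prod, Fintype.card_fin, Fintype.card_bool, Fintype.card_fun]
    have h1 : k ≤ 2 ^ k := Nat.lt_two_pow_self.le
    calc k * ((Δ + 2) * (Δ + 2) * (2 * 2 * (2 * (2 ^ k * (Δ + 2) ^ k))))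
        ≤ 2 ^ k * (2 ^ b * 2 ^ b * (2 * 2 * (2 * (2 ^ k * (2 ^ b) ^ k)))) := by gcongr
      _ = _ := by
        rw [← pow_mul]
        ring

/-- A memory needs `O(k log Δ)` bits. -/
theorem exists_fitsInBits (k Δ : ℕ) : ∃ B : ℕ,
    (B : ℝ) ≤ 14 * (k * Real.logb 2 (max 2 Δ : ℕ)) ∧ FitsInBits (memoryContents.{u} k Δ) B := by
  rcases Nat.eq_zero_or_pos k with rfl | hk
  · refine ⟨0, by simp, fun _ _ => false, ?_⟩
    rintro ⟨i, -⟩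
    exact i.elim0
  · set D := max 2 Δ with hD
    have hlog : (Nat.log 2 D : ℝ) ≤ Real.logb 2 D := by
      exact_mod_cast Real.natLog_le_logb D 2
    have hlog1 : 1 ≤ Real.logb 2 D := by
      rw [Real.le_logb_iff_rpow_le (by norm_num) (by positivity), Real.rpow_one]
      exact_mod_cast le_max_left 2 Δ
    refine ⟨_, ?_, memoryContents_fitsInBits k Δ (Nat.log 2 D + 2) ?_⟩
    · have hk' : (1 : ℝ) ≤ k := by exact_mod_cast hk
      set ℓ := Real.logb 2 D
      push_cast
      have h1 : (Nat.log 2 D : ℝ) * k ≤ ℓ * k := by gcongr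
      have h2 : 0 ≤ (ℓ - 1) * (k - 1) := mul_nonneg (by linarith) (by linarith)
      nlinarith
    · have h1 : D < 2 ^ (Nat.log 2 D + 1) := Nat.lt_pow_succ_log_self (by norm_num) D
      rw [pow_succ]
      omega

end Storage

/-! ### The round counter and the theorem -/

/-- A counter of `4m - 2(n-1)` rounds needs `O(log n)` bits. -/
theorem size_loopBound_le {V : Type u} [Fintype V] [DecidableEq V] (G : SimpleGraph V)
    [DecidableRel G.Adj] [Nonempty V] :
    ((loopBound G).size : ℝ) ≤ 14 * Real.logb 2 (Fintype.card V) := by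
  set n := Fintype.card V with hn
  have hn0 : 0 < n := Fintype.card_pos
  have hm : G.edgeFinset.card ≤ n * (n - 1) / 2 := by
    rw [← Nat.choose_two_right]
    exact G.card_edgeFinset_le_card_choose_two
  have hT : loopBound G ≤ 2 * (n * (n - 1)) := by
    unfold loopBound
    omega
  rcases Nat.lt_or_ge 1 n with h | h
  · have hlog : (Nat.log 2 n : ℝ) ≤ Real.logb 2 n := by
      exact_mod_cast Real.natLog_le_logb n 2
    have hlog1 : 1 ≤ Real.logb 2 n := by
      rw [Real.le_logb_iff_rpow_le (by norm_num) (by positivity), Real.rpow_one]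
      exact_mod_cast h
    have hsize : (loopBound G).size ≤ 2 * (Nat.log 2 n + 1) + 1 := by
      rw [Nat.size_le]
      have h1 : n < 2 ^ (Nat.log 2 n + 1) := Nat.lt_pow_succ_log_self (by norm_num) n
      have h2 : n * (n - 1) < 2 ^ (Nat.log 2 n + 1) * 2 ^ (Nat.log 2 n + 1) :=
        Nat.mul_lt_mul'' h1 (by omega)
      rw [pow_succ, two_mul (Nat.log 2 n + 1), pow_add]
      omega
    have : ((loopBound G).size : ℝ) ≤ 2 * (Nat.log 2 n + 1) + 1 := by exact_mod_cast hsize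
    linarith
  · have hn1 : n = 1 := by omega
    have : loopBound G = 0 := by
      rw [hn1] at hT
      omega
    simp [this, hn1]

end Dispersion

theorem theorem2 :
    ∃ C : ℕ,
      (∀ (V : Type u) [Fintype V] [DecidableEq V] (G : SimpleGraph V) [DecidableRel G.Adj]
          (ports : Dispersion.PortLabelling G) (k : ℕ) (start : Fin k → V)
          (mutex : Dispersion.Mutex V k) (L : ℕ∞),
        G.Connected →
        (L = (Dispersion.loopBound G : ℕ∞) ∨ L = ⊤) →
        let E : ℕ → Dispersion.Config V k := Dispersion.execution ports start mutex L
        let n : ℕ := Fintype.card V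
        let m : ℕ := G.edgeFinset.card
        let T : ℕ := 4 * m - 2 * (n - 1)
        -- a robot that does not dock within `T` rounds visits every node
        (∀ i : Fin k, ¬ (E T).Docked i → ∀ v : V, ∃ t ≤ T, (E t).pos i = v) ∧
        -- dispersion, within `T` rounds (one round if there is a single node)
        (k ≤ n → ∀ t : ℕ, max 1 T ≤ t →
          (∀ i : Fin k, (E t).Docked i ∧ (E t).pos i = (E T).pos i) ∧
          Function.Injective (E t).pos) ∧
        -- the number of rounds, and the number of bits of a round counter
        T ≤ C * m ∧
        (T.size : ℝ) ≤ C * Real.logb 2 n) ∧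
      -- the memory of a robot
      (∀ k Δ : ℕ, ∃ B : ℕ, (B : ℝ) ≤ C * (k * Real.logb 2 (max 2 Δ : ℕ)) ∧
        Dispersion.FitsInBits (Dispersion.memoryContents.{u} k Δ) B) := by
  refine ⟨14, ?_, fun k Δ => Dispersion.exists_fitsInBits k Δ⟩
  intro V _ _ G _ ports k start mutex L hG hL E n m T
  have := hG.nonempty
  refine ⟨fun i hi v => Dispersion.exists_pos_of_not_docked ports start mutex hG hL hi v,
    fun hk t ht => ?_, ?_, Dispersion.size_loopBound_le G⟩
  · have hdock : ∀ i, (E (max 1 T)).Docked i := fun i =>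
      Dispersion.docked_of_le_card ports start mutex hG hL hk i
    have hmono := fun i => Dispersion.docked_execution_mono ports start mutex ht (hdock i)
    refine ⟨fun i => ⟨(hmono i).1, ?_⟩, fun i j hij => ?_⟩
    · rcases Nat.eq_zero_or_pos T with hT | hT
      -- without any rounds the positions agree because there is a single node
      · have : Subsingleton V := by
          rw [← Fintype.card_le_one_iff_subsingleton]
          by_contra hn
          exact (Dispersion.loopBound_pos ports hG (by omega)).ne' hT
        exact Subsingleton.elim _ _
      · have := (hmono i).2
        rwa [max_eq_right (show 1 ≤ T from hT)] at this
    · exact Dispersion.dockedInjective_execution ports start mutex t i j (hmono i).1 (hmono j).1 hij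
  · change 4 * m - 2 * (n - 1) ≤ 14 * m
    omega
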